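/- Let $q = e^{2\pi i z}$ and $q^{1/2} = e^{\pi i z}$ for $z$ in the upper half-plane $\mathbb{H}$, let $\sigma_a(n) = \sum_{d \mid n} d^a$, and let $$E_2 = 1 - 24\sum_{n\ge 1}\sigma_1(n)q^n,\qquad E_4 = 1 + 240\sum_{n\ge 1}\sigma_3(n)q^n,\qquad E_6 = 1 - 504\sum_{n\ge 1}\sigma_5(n)q^n,$$ $$\Theta_2 = \sum_{n\in\mathbb{Z}} q^{\frac12 (n+\frac12)^2},\qquad \Theta_3 = \sum_{n\in\mathbb{Z}} q^{\frac{n^2}{2}},\qquad \Theta_4 = \sum_{n\in\mathbb{Z}} (-1)^n q^{\frac{n^2}{2}}.$$ Define functions on $\mathbb{H}$ by $$\phi_0 = 1728\,\frac{(E_2E_4-E_6)^2}{E_4^3-E_6^2},\qquad \psi_S = -128\left(\frac{\Theta_3^4+\Theta_2^4}{\Theta_4^8}+\frac{\Theta_2^4-\Theta_4^4}{\Theta_3^8}\right).$$ Then for all $t>0$ the numbers $\phi_0(it)$ and $\psi_S(it)$ are real, and $$\phi_0(it) - \frac{36}{\pi^2}\,\psi_S(it) > 0 \qquad\text{and}\qquad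 \phi_0(it) + \frac{36}{\pi^2}\,\psi_S(it) < 0.$$ -/

import Mathlib

open scoped UpperHalfPlane ComplexOrder

noncomputable section

namespace DimEight

/-- The thetanull function `Θ₂(z) = ∑_{n ∈ ℤ} q^{(n + 1/2)² / 2}`, with `q^{1/2} = e^{π i z}`. -/
def Theta2 (z : ℍ) : ℂ :=
  ∑' n : ℤ, Complex.exp (Real.pi * Complex.I * ((n : ℂ) + 1 / 2) ^ 2 * (z : ℂ))

/-- The thetanull function `Θ₃(z) = ∑_{n ∈ ℤ} q^{n² / 2}`, with `q^{1/2} = e^{π i z}`. -/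
def Theta3 (z : ℍ) : ℂ :=
  ∑' n : ℤ, Complex.exp (Real.pi * Complex.I * (n : ℂ) ^ 2 * (z : ℂ))

/-- The thetanull function `Θ₄(z) = ∑_{n ∈ ℤ} (-1)ⁿ q^{n² / 2}`, with `q^{1/2} = e^{π i z}`. -/
def Theta4 (z : ℍ) : ℂ :=
  ∑' n : ℤ, (-1 : ℂ) ^ n * Complex.exp (Real.pi * Complex.I * (n : ℂ) ^ 2 * (z : ℂ))

/-- `φ₀ = 1728 (E₂ E₄ - E₆)² / (E₄³ - E₆²)`. The Eisenstein series are the normalized ones,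
`E₂ = 1 - 24 ∑ σ₁(n) qⁿ`, `E₄ = 1 + 240 ∑ σ₃(n) qⁿ`, `E₆ = 1 - 504 ∑ σ₅(n) qⁿ`. -/
def phi0 (z : ℍ) : ℂ :=
  1728 * ((EisensteinSeries.E2 z * ModularForm.E₄ z - ModularForm.E₆ z) ^ 2 /
    (ModularForm.E₄ z ^ 3 - ModularForm.E₆ z ^ 2))

/-- `ψ_S = -128 ((Θ₃⁴ + Θ₂⁴) / Θ₄⁸ + (Θ₂⁴ - Θ₄⁴) / Θ₃⁸)`. -/
def psiS (z : ℍ) : ℂ :=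
  -128 * ((Theta3 z ^ 4 + Theta2 z ^ 4) / Theta4 z ^ 8 +
    (Theta2 z ^ 4 - Theta4 z ^ 4) / Theta3 z ^ 8)

/-- The point `it` of the upper half-plane, for `t > 0`. -/
def imagPoint (t : ℝ) (ht : 0 < t) : ℍ :=
  ⟨Complex.I * (t : ℂ), by simpa using ht⟩

end DimEight

end

/-! Both inequalities follow from 0 ≤ φ₀(it) < -(36/π²)ψ_S(it), which is `realPhi0_lt`. Put p =
e^{-πt} and q = p². For t ≥ 1, φ₀ has order q, because E₂E₄ - E₆ and E₄³ - E₆² both vanish to first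
order in q, whereas -ψ_S has the larger order p. Explicit enclosures make this effective down to t =
1 (`realPhi0_lt_of_one_le`). For t ≤ 1, the map z ↦ -1/z leads back to t ≥ 1 (`realPhi0_inv`,
`realPsiS_inv`). Once the common factor 36/(πt)² is removed, both sides have leading term 1/q, so
36/π² is exactly critical and the next term decides: the Eisenstein side is at most 1/q - 175
(`eisenstein_quotient_le`), the theta side at least 1/q - 98 (`le_theta_quotient`). -/

namespace DimEight

open EisensteinSeries ModularForm ArithmeticFunction
open scoped ArithmeticFunction.sigma

/-! ### Divisor sums and Eisenstein series on the imaginary axis -/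

/-- The divisor series `∑ σ_k(n) qⁿ` over `n ≥ 1`, at a real argument. -/
noncomputable def sigmaSeries (k : ℕ) (q : ℝ) : ℝ := ∑' n : ℕ, (σ k (n + 1) : ℝ) * q ^ (n + 1)

lemma sigmaSeries_mem_Icc {k : ℕ} {b q : ℝ} (hb : 0 ≤ b) (hσ : ∀ n, (σ k (n + 1) : ℝ) ≤ b ^ n)
    (hq : 0 < q) (hbq : b * q < 1) :
    sigmaSeries k q ∈ Set.Icc q (q / (1 - b * q)) := by
  have hg : HasSum (fun n : ℕ ↦ q * (b * q) ^ n) (q / (1 - b * q)) := by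
    simpa [div_eq_mul_inv] using (hasSum_geometric_of_lt_one (by positivity) hbq).mul_left q
  have hle : ∀ n, (σ k (n + 1) : ℝ) * q ^ (n + 1) ≤ q * (b * q) ^ n := fun n ↦ by
    calc (σ k (n + 1) : ℝ) * q ^ (n + 1) ≤ b ^ n * q ^ (n + 1) := by gcongr; exact hσ n
      _ = q * (b * q) ^ n := by ring
  have hs : Summable fun n : ℕ ↦ (σ k (n + 1) : ℝ) * q ^ (n + 1) :=
    .of_nonneg_of_le (fun n ↦ by positivity) hle hg.summable
  refine ⟨?_, hg.tsum_eq ▸ hs.tsum_le_tsum hle hg.summable⟩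
  simpa [sigmaSeries] using hs.le_tsum 0 fun n _ ↦ by positivity

lemma sigma_one_le (n : ℕ) : (σ 1 (n + 1) : ℝ) ≤ 4 ^ n := by
  have h : (n + 1) ^ 2 ≤ 4 ^ n := by
    induction n with
    | zero => simp
    | succ m ih =>
      have h1 : (m + 1 + 1) ^ 2 ≤ (2 * (m + 1)) ^ 2 := Nat.pow_le_pow_left (by omega) 2
      rw [mul_pow] at h1
      rw [pow_succ 4]
      omega
  exact_mod_cast (sigma_le_pow_succ 1 (n + 1)).trans h

lemma sigma_three_le (n : ℕ) : (σ 3 (n + 1) : ℝ) ≤ 9 ^ n := by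
  -- The crude bound σ₃(m) ≤ m⁴ gives 16 > 9 at m = 2, so that case is computed; from m = 3 on it
  -- suffices.
  rcases n with _ | _ | n
  · simp
  · have : σ 3 2 = 9 := by decide +kernel
    simp [this]
  have h : (n + 3) ^ 4 ≤ 9 ^ (n + 2) := by
    induction n with
    | zero => simp
    | succ m ih =>
      have h1 : (3 * (m + 1 + 3)) ^ 4 ≤ (4 * (m + 3)) ^ 4 := Nat.pow_le_pow_left (by omega) 4
      rw [mul_pow, mul_pow] at h1
      rw [show m + 1 + 2 = m + 2 + 1 by ring, pow_succ 9]
      omega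
  exact_mod_cast (sigma_le_pow_succ 3 (n + 3)).trans h

lemma sigma_five_le (n : ℕ) : (σ 5 (n + 1) : ℝ) ≤ 33 ^ n := by
  rcases n with _ | _ | n
  · simp
  · have : σ 5 2 = 33 := by decide +kernel
    simp [this]
  have h : (n + 3) ^ 6 ≤ 33 ^ (n + 2) := by
    induction n with
    | zero => simp
    | succ m ih =>
      have h1 : (3 * (m + 1 + 3)) ^ 6 ≤ (4 * (m + 3)) ^ 6 := Nat.pow_le_pow_left (by omega) 6
      rw [mul_pow, mul_pow] at h1
      rw [show m + 1 + 2 = m + 2 + 1 by ring, pow_succ 33]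
      omega
  exact_mod_cast (sigma_le_pow_succ 5 (n + 3)).trans h

lemma cexp_imagPoint (t : ℝ) (ht : 0 < t) :
    Complex.exp (2 * Real.pi * Complex.I * (imagPoint t ht : ℂ)) =
      (Real.exp (-2 * Real.pi * t) : ℝ) := by
  rw [Complex.ofReal_exp]
  congr 1
  simp only [imagPoint]
  push_cast
  linear_combination (2 * Real.pi * t : ℂ) * Complex.I_mul_I

lemma tsum_sigma_cexp_imagPoint (k : ℕ) (t : ℝ) (ht : 0 < t) :
    ∑' n : ℕ+, (σ k n : ℂ) *
      Complex.exp (2 * Real.pi * Complex.I * (imagPoint t ht : ℂ)) ^ (n : ℕ) =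
      (sigmaSeries k (Real.exp (-2 * Real.pi * t)) : ℝ) := by
  rw [cexp_imagPoint, sigmaSeries, tsum_pnat_eq_tsum_succ
    (f := fun n ↦ (σ k n : ℂ) * ((Real.exp (-2 * Real.pi * t) : ℝ) : ℂ) ^ n), Complex.ofReal_tsum]
  simp only [Complex.ofReal_mul, Complex.ofReal_pow, Complex.ofReal_natCast]

/-- The restriction of `E₂` to the imaginary axis. -/
noncomputable def realE2 (t : ℝ) : ℝ := 1 - 24 * sigmaSeries 1 (Real.exp (-2 * Real.pi * t))

/-- The restriction of `E₄` to the imaginary axis. -/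
noncomputable def realE4 (t : ℝ) : ℝ := 1 + 240 * sigmaSeries 3 (Real.exp (-2 * Real.pi * t))

/-- The restriction of `E₆` to the imaginary axis. -/
noncomputable def realE6 (t : ℝ) : ℝ := 1 - 504 * sigmaSeries 5 (Real.exp (-2 * Real.pi * t))

lemma E2_imagPoint (t : ℝ) (ht : 0 < t) : E2 (imagPoint t ht) = (realE2 t : ℝ) := by
  rw [E2_eq_tsum_cexp, tsum_sigma_cexp_imagPoint, realE2]
  push_cast
  rfl

lemma E4_imagPoint (t : ℝ) (ht : 0 < t) : E₄ (imagPoint t ht) = (realE4 t : ℝ) := by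
  rw [q_expansion_bernoulli (by norm_num) ⟨2, rfl⟩, show bernoulli 4 = -1 / 30 by decide +kernel]
  simp only [zpow_natCast]
  rw [tsum_sigma_cexp_imagPoint, realE4]
  push_cast
  ring

lemma E6_imagPoint (t : ℝ) (ht : 0 < t) : E₆ (imagPoint t ht) = (realE6 t : ℝ) := by
  rw [q_expansion_bernoulli (by norm_num) ⟨3, rfl⟩, show bernoulli 6 = 1 / 42 by decide +kernel]
  simp only [zpow_natCast]
  rw [tsum_sigma_cexp_imagPoint, realE6]
  push_cast
  ring

/-! ### Eisenstein series under t ↦ 1/t -/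

lemma neg_inv_imagPoint (t : ℝ) (ht : 0 < t) :
    (-(imagPoint t ht : ℂ))⁻¹ = (imagPoint t⁻¹ (inv_pos.mpr ht) : ℂ) := by
  simp only [imagPoint]
  push_cast
  rw [inv_eq_iff_eq_inv, mul_inv, inv_inv, Complex.inv_I, neg_mul]

lemma S_smul_imagPoint (t : ℝ) (ht : 0 < t) :
    ModularGroup.S • imagPoint t ht = imagPoint t⁻¹ (inv_pos.mpr ht) := by
  rw [UpperHalfPlane.modular_S_smul]
  exact UpperHalfPlane.ext (neg_inv_imagPoint t ht)

lemma modularForm_S_smul {k : ℤ} (f : ModularForm (Matrix.SpecialLinearGroup.mapGL ℝ :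
    Matrix.SpecialLinearGroup (Fin 2) ℤ →* GL (Fin 2) ℝ).range k) (z : ℍ) :
    f (ModularGroup.S • z) = (z : ℂ) ^ k * f z := by
  have h := SlashInvariantFormClass.slash_action_eq f _ ⟨ModularGroup.S, rfl⟩
  have h2 := SlashInvariantForm.slash_S_apply f k z
  rw [← UpperHalfPlane.modular_S_smul] at h2
  have h3 : f z = f (ModularGroup.S • z) * (z : ℂ) ^ (-k) := by
    rw [← h2]; exact (congrFun h z).symm
  rw [h3, mul_comm, mul_assoc, ← zpow_add₀ z.ne_zero]
  simp

lemma realE4_inv {t : ℝ} (ht : 0 < t) : realE4 t⁻¹ = t ^ 4 * realE4 t := by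
  have h := modularForm_S_smul E₄ (imagPoint t ht)
  rw [S_smul_imagPoint, E4_imagPoint, E4_imagPoint] at h
  have hI : ((imagPoint t ht : ℂ)) ^ (4 : ℤ) = (t : ℂ) ^ 4 := by
    simp only [imagPoint]
    rw [show (4 : ℤ) = (4 : ℕ) from rfl, zpow_natCast, mul_pow, Complex.I_pow_four, one_mul]
  rw [hI] at h
  exact_mod_cast h

lemma realE6_inv {t : ℝ} (ht : 0 < t) : realE6 t⁻¹ = -t ^ 6 * realE6 t := by
  have h := modularForm_S_smul E₆ (imagPoint t ht)
  rw [S_smul_imagPoint, E6_imagPoint, E6_imagPoint] at h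
  have hI : ((imagPoint t ht : ℂ)) ^ (6 : ℤ) = -(t : ℂ) ^ 6 := by
    simp only [imagPoint]
    rw [show (6 : ℤ) = (6 : ℕ) from rfl, zpow_natCast, mul_pow,
      show Complex.I ^ 6 = Complex.I ^ 4 * Complex.I ^ 2 by ring, Complex.I_pow_four, Complex.I_sq]
    ring
  rw [hI] at h
  exact_mod_cast h

lemma realE2_inv {t : ℝ} (ht : 0 < t) : realE2 t⁻¹ = -t ^ 2 * realE2 t + 6 * t / Real.pi := by
  have h := G2_S_transform (imagPoint t ht)
  have hE (z : ℍ) : G2 z = Real.pi ^ 2 / 3 * E2 z := by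
    simp only [E2, Pi.smul_apply, smul_eq_mul, riemannZeta_two]
    have : (Real.pi : ℂ) ≠ 0 := mod_cast Real.pi_ne_zero
    field_simp
    ring
  rw [hE, hE, S_smul_imagPoint, E2_imagPoint, E2_imagPoint] at h
  simp only [imagPoint] at h
  have h1 : (t : ℂ) ≠ 0 := mod_cast ht.ne'
  have h2 : (Real.pi : ℂ) ≠ 0 := mod_cast Real.pi_ne_zero
  have h3 : Complex.I ≠ 0 := Complex.I_ne_zero
  have key : (realE2 t⁻¹ : ℂ) = -t ^ 2 * realE2 t + 6 * t / Real.pi := by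
    rw [mul_pow, Complex.I_sq] at h
    field_simp at h ⊢
    linear_combination h
  exact_mod_cast key

/-! ### Theta functions: inversion, one-sided series, bounds -/

/-- The restriction of `Θ₂` to the imaginary axis. -/
noncomputable def realTheta2 (t : ℝ) : ℝ := ∑' n : ℤ, Real.exp (-Real.pi * t * (n + 1 / 2) ^ 2)

/-- The restriction of `Θ₃` to the imaginary axis. -/
noncomputable def realTheta3 (t : ℝ) : ℝ := ∑' n : ℤ, Real.exp (-Real.pi * t * n ^ 2)

/-- The restriction of `Θ₄` to the imaginary axis. -/
noncomputable def realTheta4 (t : ℝ) : ℝ :=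
  ∑' n : ℤ, (-1) ^ n * Real.exp (-Real.pi * t * n ^ 2)

lemma Theta2_imagPoint (t : ℝ) (ht : 0 < t) : Theta2 (imagPoint t ht) = (realTheta2 t : ℝ) := by
  rw [Theta2, realTheta2, Complex.ofReal_tsum]
  refine tsum_congr fun n ↦ ?_
  push_cast
  congr 1
  simp only [imagPoint]
  linear_combination (Real.pi * t * (n + 1 / 2) ^ 2 : ℂ) * Complex.I_mul_I

lemma Theta3_imagPoint (t : ℝ) (ht : 0 < t) : Theta3 (imagPoint t ht) = (realTheta3 t : ℝ) := by
  rw [Theta3, realTheta3, Complex.ofReal_tsum]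
  refine tsum_congr fun n ↦ ?_
  push_cast
  congr 1
  simp only [imagPoint]
  linear_combination (Real.pi * t * n ^ 2 : ℂ) * Complex.I_mul_I

lemma Theta4_imagPoint (t : ℝ) (ht : 0 < t) : Theta4 (imagPoint t ht) = (realTheta4 t : ℝ) := by
  rw [Theta4, realTheta4, Complex.ofReal_tsum]
  refine tsum_congr fun n ↦ ?_
  push_cast
  congr 2
  simp only [imagPoint]
  linear_combination (Real.pi * t * n ^ 2 : ℂ) * Complex.I_mul_I

lemma realTheta3_inv {t : ℝ} (ht : 0 < t) : realTheta3 t⁻¹ ^ 4 = t ^ 2 * realTheta3 t ^ 4 := by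
  have h := Real.tsum_exp_neg_mul_int_sq (inv_pos.mpr ht)
  rw [div_inv_eq_mul] at h
  rw [realTheta3, h, ← realTheta3, mul_pow]
  congr 1
  rw [Real.inv_rpow ht.le, one_div, inv_inv, ← Real.rpow_mul_natCast ht.le]
  norm_num

lemma Theta4_eq_jacobiTheta₂ (z : ℍ) : Theta4 z = jacobiTheta₂ (1 / 2) z := by
  refine tsum_congr fun n ↦ ?_
  rw [jacobiTheta₂_term, Complex.exp_add, show (2 * Real.pi * Complex.I * n * (1 / 2) : ℂ) =
    n * (Real.pi * Complex.I) by ring, Complex.exp_int_mul, Complex.exp_pi_mul_I]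

lemma Theta2_eq_jacobiTheta₂ (z : ℍ) :
    Theta2 z = Complex.exp (Real.pi * Complex.I * z / 4) * jacobiTheta₂ (z / 2) z := by
  rw [jacobiTheta₂, ← tsum_mul_left]
  refine tsum_congr fun n ↦ ?_
  rw [jacobiTheta₂_term, ← Complex.exp_add]
  congr 1
  ring

/-- The functional equation of `jacobiTheta₂` at 1/2 turns Θ₄ into Θ₂; the fourth power turns its
factor t^{1/2} into t². -/
lemma realTheta4_eq {t : ℝ} (ht : 0 < t) :
    realTheta4 t ^ 4 = (t ^ 2)⁻¹ * realTheta2 t⁻¹ ^ 4 := by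
  have h := jacobiTheta₂_functional_equation (1 / 2) (imagPoint t ht)
  rw [← Theta4_eq_jacobiTheta₂] at h
  have h1 : (-1 / (imagPoint t ht : ℂ)) = (imagPoint t⁻¹ (inv_pos.mpr ht) : ℂ) := by
    rw [← neg_inv_imagPoint t ht, ← neg_inv, neg_div, one_div]
  have h2 : (1 / 2 / (imagPoint t ht : ℂ)) = -((imagPoint t⁻¹ (inv_pos.mpr ht) : ℂ) / 2) := by
    rw [← h1]; ring
  have h3 : (-Real.pi * Complex.I * (1 / 2) ^ 2 / (imagPoint t ht : ℂ)) =
      Real.pi * Complex.I * (imagPoint t⁻¹ (inv_pos.mpr ht) : ℂ) / 4 := by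
    rw [← h1]; ring
  have h4 : -Complex.I * (imagPoint t ht : ℂ) = t := by
    simp only [imagPoint]
    linear_combination (-t : ℂ) * Complex.I_mul_I
  have h5 : ((t : ℂ) ^ (1 / 2 : ℂ)) ^ 4 = t ^ 2 := by
    rw [← Complex.cpow_nat_mul]
    norm_num
  rw [h1, h2, h3, h4, jacobiTheta₂_neg_left, mul_assoc, ← Theta2_eq_jacobiTheta₂,
    Theta2_imagPoint, Theta4_imagPoint] at h
  have key : (realTheta4 t : ℂ) ^ 4 = ((t : ℂ) ^ 2)⁻¹ * realTheta2 t⁻¹ ^ 4 := by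
    rw [h, mul_pow, div_pow, h5]
    simp
  exact_mod_cast key

lemma realTheta4_inv {t : ℝ} (ht : 0 < t) : realTheta4 t⁻¹ ^ 4 = t ^ 2 * realTheta2 t ^ 4 := by
  rw [realTheta4_eq (inv_pos.mpr ht), inv_inv]
  simp

lemma realTheta2_inv {t : ℝ} (ht : 0 < t) : realTheta2 t⁻¹ ^ 4 = t ^ 2 * realTheta4 t ^ 4 := by
  rw [realTheta4_eq ht, mul_inv_cancel_left₀ (by positivity)]

lemma hasSum_realTheta3 {t : ℝ} (ht : 0 < t) :
    HasSum (fun n : ℕ ↦ Real.exp (-Real.pi * t) ^ (n + 1) ^ 2) ((realTheta3 t - 1) / 2) := by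
  have h := hasSum_nat_jacobiTheta (τ := imagPoint t ht) (imagPoint t ht).2
  rw [show jacobiTheta (imagPoint t ht : ℂ) = Theta3 (imagPoint t ht) from rfl,
    Theta3_imagPoint] at h
  rw [← Complex.hasSum_ofReal]
  convert h using 1
  · ext n
    rw [← Real.exp_nat_mul, Complex.ofReal_exp]
    congr 1
    simp only [imagPoint]
    push_cast
    linear_combination (-Real.pi * t * (n + 1) ^ 2 : ℂ) * Complex.I_mul_I
  · push_cast; rfl

lemma hasSum_realTheta4 {t : ℝ} (ht : 0 < t) :
    HasSum (fun n : ℕ ↦ (-1) ^ (n + 1) * Real.exp (-Real.pi * t) ^ (n + 1) ^ 2)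
      ((realTheta4 t - 1) / 2) := by
  have h := hasSum_nat_jacobiTheta (τ := (imagPoint t ht : ℂ) + 1)
    (by simpa using (imagPoint t ht).2)
  -- As n² and n have the same parity, Θ₄(z) is the Jacobi theta function at z + 1.
  have hsq (n : ℤ) : Complex.exp (Real.pi * Complex.I * (n : ℂ) ^ 2) = (-1) ^ n := by
    rw [show (Real.pi * Complex.I * (n : ℂ) ^ 2 : ℂ) = ((n ^ 2 : ℤ) : ℂ) * (Real.pi * Complex.I) by
      push_cast; ring, Complex.exp_int_mul, Complex.exp_pi_mul_I]
    rcases Int.even_or_odd n with hn | hn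
    · rw [hn.neg_one_zpow, (hn.pow_of_ne_zero two_ne_zero).neg_one_zpow]
    · rw [hn.neg_one_zpow, hn.pow.neg_one_zpow]
  rw [show jacobiTheta ((imagPoint t ht : ℂ) + 1) = Theta4 (imagPoint t ht) from
    tsum_congr fun n ↦ by rw [mul_add, mul_one, Complex.exp_add, hsq, mul_comm],
    Theta4_imagPoint] at h
  rw [← Complex.hasSum_ofReal]
  convert h using 1
  · ext n
    have := hsq (n + 1)
    rw [mul_add, mul_one, Complex.exp_add]
    push_cast at this
    rw [this, mul_comm]
    push_cast
    rw [← Complex.exp_nat_mul]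
    congr 2
    simp only [imagPoint]
    push_cast
    linear_combination (-Real.pi * t * (n + 1) ^ 2 : ℂ) * Complex.I_mul_I
  · push_cast; rfl

/-- The symmetry n ↦ -n - 1 folds the sum over ℤ into twice a sum over ℕ. -/
lemma hasSum_realTheta2 {t : ℝ} (ht : 0 < t) :
    HasSum (fun n : ℕ ↦ 2 * Real.exp (-Real.pi * t / 4) * Real.exp (-Real.pi * t) ^ (n * (n + 1)))
      (realTheta2 t) := by
  set c := Real.exp (-Real.pi * t / 4) with hc
  set p := Real.exp (-Real.pi * t) with hp
  have hp1 : p < 1 := by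
    rw [hp, Real.exp_lt_one_iff]
    nlinarith [Real.pi_pos]
  have hs : Summable fun n : ℕ ↦ c * p ^ (n * (n + 1)) := by
    refine .mul_left c (.of_nonneg_of_le (fun n ↦ by positivity) (fun n ↦ ?_)
      (summable_geometric_of_lt_one (Real.exp_nonneg _) hp1))
    exact pow_le_pow_of_le_one (Real.exp_nonneg _) hp1.le (Nat.le_mul_of_pos_right n n.succ_pos)
  have hf (n : ℕ) : c * p ^ (n * (n + 1)) = Real.exp (-Real.pi * t * ((n : ℝ) + 1 / 2) ^ 2) := by
    rw [hc, hp, ← Real.exp_nat_mul, ← Real.exp_add]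
    congr 1
    push_cast
    ring
  have h := HasSum.of_nat_of_neg_add_one
    (f := fun n : ℤ ↦ Real.exp (-Real.pi * t * ((n : ℝ) + 1 / 2) ^ 2))
    (m := ∑' n : ℕ, c * p ^ (n * (n + 1))) (m' := ∑' n : ℕ, c * p ^ (n * (n + 1)))
    (by simpa only [hf, Int.cast_natCast] using hs.hasSum)
    (by
      convert hs.hasSum using 2 with n
      rw [hf]
      congr 1
      push_cast
      ring)
  rw [realTheta2, h.tsum_eq]
  convert hs.hasSum.add hs.hasSum using 2 with n
  ring

lemma realTheta2_pow_mem_Icc {t : ℝ} (ht : 0 < t) : realTheta2 t ^ 4 ∈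
    Set.Icc (16 * Real.exp (-Real.pi * t))
      (16 * Real.exp (-Real.pi * t) / (1 - Real.exp (-Real.pi * t) ^ 2) ^ 4) := by
  have h := hasSum_realTheta2 ht
  have hc : Real.exp (-Real.pi * t / 4) ^ 4 = Real.exp (-Real.pi * t) := by
    rw [← Real.exp_nat_mul]
    congr 1
    push_cast
    ring
  have hp1 : Real.exp (-Real.pi * t) < 1 := by
    rw [Real.exp_lt_one_iff]
    nlinarith [Real.pi_pos]
  set c := Real.exp (-Real.pi * t / 4)
  set p := Real.exp (-Real.pi * t)
  have hp0 : 0 < p := Real.exp_pos _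
  have hc0 : 0 < c := Real.exp_pos _
  have hg : HasSum (fun n : ℕ ↦ 2 * c * (p ^ 2) ^ n) (2 * c * (1 - p ^ 2)⁻¹) :=
    (hasSum_geometric_of_lt_one (by positivity) (pow_lt_one₀ hp0.le hp1 two_ne_zero)).mul_left _
  have hlo : 2 * c ≤ realTheta2 t := by
    simpa using le_hasSum h 0 fun n _ ↦ by positivity
  have hhi : realTheta2 t ≤ 2 * c * (1 - p ^ 2)⁻¹ := by
    refine hasSum_le (fun n ↦ ?_) h hg
    rw [← pow_mul]
    refine mul_le_mul_of_nonneg_left (pow_le_pow_of_le_one hp0.le hp1.le ?_) (by positivity)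
    rcases n with _ | n
    · simp
    · nlinarith
  constructor
  · calc 16 * p = (2 * c) ^ 4 := by rw [← hc]; ring
      _ ≤ _ := by gcongr
  · calc realTheta2 t ^ 4 ≤ (2 * c * (1 - p ^ 2)⁻¹) ^ 4 := by
          have : 0 ≤ realTheta2 t := by linarith
          gcongr
      _ = _ := by rw [← hc]; field_simp; ring

lemma le_realTheta3 {t : ℝ} (ht : 0 < t) : 1 + 2 * Real.exp (-Real.pi * t) ≤ realTheta3 t := by
  have h := le_hasSum (hasSum_realTheta3 ht) 0 fun n _ ↦ by positivity
  norm_num at h ⊢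
  linarith

/-- Odd powers of p cancel and even ones double. -/
lemma two_le_realTheta3_add_realTheta4 {t : ℝ} (ht : 0 < t) :
    2 ≤ realTheta3 t + realTheta4 t := by
  have h := ((hasSum_realTheta3 ht).add (hasSum_realTheta4 ht)).nonneg fun n ↦ by
    rcases neg_one_pow_eq_or ℝ (n + 1) with h | h <;> rw [h] <;> simp
    positivity
  linarith

lemma abs_realTheta4_sub_le {t : ℝ} (ht : 0 < t) :
    |realTheta4 t - (1 - 2 * Real.exp (-Real.pi * t))| ≤
      2 * Real.exp (-Real.pi * t) ^ 4 / (1 - Real.exp (-Real.pi * t)) := by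
  have hp1 : Real.exp (-Real.pi * t) < 1 := by
    rw [Real.exp_lt_one_iff]
    nlinarith [Real.pi_pos]
  have h := (hasSum_nat_add_iff' 1).mpr (hasSum_realTheta4 ht)
  set p := Real.exp (-Real.pi * t)
  have hp0 : 0 < p := Real.exp_pos _
  have hg : HasSum (fun n : ℕ ↦ p ^ 4 * p ^ n) (p ^ 4 * (1 - p)⁻¹) :=
    (hasSum_geometric_of_lt_one hp0.le hp1).mul_left _
  have hb := tsum_of_norm_bounded hg (f := fun n : ℕ ↦ (-1) ^ (n + 1 + 1) * p ^ (n + 1 + 1) ^ 2)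
    fun n ↦ by
      rw [norm_mul, norm_pow, norm_neg, norm_one, one_pow, one_mul, norm_pow,
        Real.norm_of_nonneg hp0.le, ← pow_add]
      exact pow_le_pow_of_le_one hp0.le hp1.le (by nlinarith)
  rw [h.tsum_eq, Real.norm_eq_abs] at hb
  have he : realTheta4 t - (1 - 2 * p) = 2 * ((realTheta4 t - 1) / 2 -
      ∑ i ∈ Finset.range 1, (-1) ^ (i + 1) * p ^ (i + 1) ^ 2) := by
    simp
    ring
  rw [he, abs_mul, abs_two, mul_div_assoc]
  rw [← div_eq_mul_inv] at hb
  linarith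

/-! ### Numerical enclosures for t ≥ 1 -/

lemma exp_neg_pi_lt : Real.exp (-Real.pi) < 0.04324 := by
  have h1 : Real.exp (-Real.pi) ≤ Real.exp (-3.1415) :=
    Real.exp_le_exp.mpr (by linarith [Real.pi_gt_d4])
  refine h1.trans_lt ?_
  rw [Real.exp_neg, show (3.1415 : ℝ) = 3 * 1 + 0.1415 by norm_num, Real.exp_add]
  have h2 : (20.085 : ℝ) < Real.exp (3 * 1) := by
    have := Real.exp_one_gt_d9
    calc (20.085 : ℝ) < 2.7182818283 ^ 3 := by norm_num
      _ < Real.exp 1 ^ 3 := by gcongr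
      _ = _ := by rw [← Real.exp_nat_mul]; norm_num
  have h3 : (1.1519 : ℝ) ≤ Real.exp 0.1415 := by
    refine le_trans ?_ (Real.sum_le_exp_of_nonneg (by norm_num) 4)
    norm_num [Finset.sum_range_succ, Nat.factorial]
  rw [inv_lt_comm₀ (by positivity) (by norm_num)]
  calc (0.04324 : ℝ)⁻¹ < 20.085 * 1.1519 := by norm_num
    _ ≤ _ := by gcongr

lemma exp_neg_two_pi_mul (t : ℝ) :
    Real.exp (-2 * Real.pi * t) = Real.exp (-Real.pi * t) ^ 2 := by
  rw [← Real.exp_nat_mul]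
  congr 1
  push_cast
  ring

lemma exp_neg_pi_mul_lt {t : ℝ} (ht : 1 ≤ t) : Real.exp (-Real.pi * t) < 0.04324 := by
  refine lt_of_le_of_lt (Real.exp_le_exp.mpr ?_) exp_neg_pi_lt
  nlinarith [Real.pi_pos]

lemma exp_neg_two_pi_mul_lt {t : ℝ} (ht : 1 ≤ t) : Real.exp (-2 * Real.pi * t) < 0.00187 := by
  rw [exp_neg_two_pi_mul]
  have := exp_neg_pi_mul_lt ht
  calc Real.exp (-Real.pi * t) ^ 2 < 0.04324 ^ 2 := by gcongr
    _ < _ := by norm_num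

/-- Controls the factor πt/6 that the quasimodularity of E₂ introduces. -/
lemma mul_exp_neg_two_pi_mul_lt {t : ℝ} (ht : 1 ≤ t) :
    t * Real.exp (-2 * Real.pi * t) < 0.00187 := by
  have h1 : t ≤ Real.exp (2 * Real.pi * (t - 1)) := by
    have := Real.add_one_le_exp (2 * Real.pi * (t - 1))
    nlinarith [Real.pi_gt_three]
  calc t * Real.exp (-2 * Real.pi * t)
      ≤ Real.exp (2 * Real.pi * (t - 1)) * Real.exp (-2 * Real.pi * t) := by gcongr
    _ = Real.exp (-2 * Real.pi * 1) := by rw [← Real.exp_add]; congr 1; ring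
    _ < _ := exp_neg_two_pi_mul_lt le_rfl

lemma sigmaSeries_mem_Icc_of_le {k : ℕ} {b c q : ℝ} (hb : 0 ≤ b)
    (hσ : ∀ n, (ArithmeticFunction.sigma k (n + 1) : ℝ) ≤ b ^ n) (hq : 0 < q) (hq' : q ≤ 0.00187)
    (hbq : b * 0.00187 < 1) (hc : 1 ≤ c * (1 - b * 0.00187)) (hc0 : 0 ≤ c) :
    q ≤ sigmaSeries k q ∧ sigmaSeries k q ≤ c * q := by
  have h1 : b * q ≤ b * 0.00187 := by gcongr
  have h := sigmaSeries_mem_Icc hb hσ hq (h1.trans_lt hbq)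
  refine ⟨h.1, h.2.trans ?_⟩
  rw [div_le_iff₀ (by linarith)]
  have h2 : 1 ≤ c * (1 - b * q) := hc.trans (by gcongr)
  nlinarith

/-- Enclosures of `E₂`, `E₄` and `E₆` at `it` for `t ≥ 1`, linear in `q = e^{-2πt}`. -/
lemma eisenstein_bounds {t : ℝ} (ht : 1 ≤ t) :
    realE2 t ∈ Set.Icc (1 - 24.2 * Real.exp (-2 * Real.pi * t))
      (1 - 24 * Real.exp (-2 * Real.pi * t)) ∧
    realE4 t ∈ Set.Icc (1 + 240 * Real.exp (-2 * Real.pi * t))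
      (1 + 244.2 * Real.exp (-2 * Real.pi * t)) ∧
    realE6 t ∈ Set.Icc (1 - 537.3 * Real.exp (-2 * Real.pi * t))
      (1 - 504 * Real.exp (-2 * Real.pi * t)) := by
  have hq0 := Real.exp_pos (-2 * Real.pi * t)
  have hq1 := (exp_neg_two_pi_mul_lt ht).le
  have h1 := sigmaSeries_mem_Icc_of_le (c := 1.008) (by norm_num) sigma_one_le hq0 hq1
    (by norm_num) (by norm_num) (by norm_num)
  have h3 := sigmaSeries_mem_Icc_of_le (c := 1.0175) (by norm_num) sigma_three_le hq0 hq1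
    (by norm_num) (by norm_num) (by norm_num)
  have h5 := sigmaSeries_mem_Icc_of_le (c := 1.066) (by norm_num) sigma_five_le hq0 hq1
    (by norm_num) (by norm_num) (by norm_num)
  simp only [realE2, realE4, realE6, Set.mem_Icc]
  refine ⟨⟨?_, ?_⟩, ⟨?_, ?_⟩, ?_, ?_⟩ <;> linarith

lemma realE2_mul_realE4_sub_realE6_mem_Icc {t : ℝ} (ht : 1 ≤ t) :
    realE2 t * realE4 t - realE6 t ∈ Set.Icc (708 * Real.exp (-2 * Real.pi * t))
      (758 * Real.exp (-2 * Real.pi * t)) := by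
  obtain ⟨⟨h2, h2'⟩, ⟨h4, h4'⟩, h6, h6'⟩ := eisenstein_bounds ht
  have hq0 := Real.exp_pos (-2 * Real.pi * t)
  have hq1 := exp_neg_two_pi_mul_lt ht
  set q := Real.exp (-2 * Real.pi * t)
  have hE2 : 0 ≤ realE2 t := by linarith
  constructor
  · have : (1 - 24.2 * q) * (1 + 240 * q) ≤ realE2 t * realE4 t := by gcongr
    nlinarith
  · have : realE2 t * realE4 t ≤ (1 - 24 * q) * (1 + 244.2 * q) := by
      gcongr <;> linarith
    nlinarith

lemma le_realE4_pow_sub_realE6_sq {t : ℝ} (ht : 1 ≤ t) :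
    1728 * Real.exp (-2 * Real.pi * t) * (1 - 47 * Real.exp (-2 * Real.pi * t)) ≤
      realE4 t ^ 3 - realE6 t ^ 2 := by
  obtain ⟨-, ⟨h4, -⟩, h6, h6'⟩ := eisenstein_bounds ht
  have hq0 := Real.exp_pos (-2 * Real.pi * t)
  have hq1 := exp_neg_two_pi_mul_lt ht
  set q := Real.exp (-2 * Real.pi * t)
  have h1 : (1 + 240 * q) ^ 3 ≤ realE4 t ^ 3 := by gcongr
  have h2 : realE6 t ^ 2 ≤ (1 - 504 * q) ^ 2 := sq_le_sq' (by linarith) h6'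
  -- (1 + 240q)³ - (1 - 504q)² = 1728q - 81216q² + 240³q³, and 81216 = 47 · 1728.
  nlinarith [pow_pos hq0 3]

lemma realE4_pow_sub_realE6_sq_pos {t : ℝ} (ht : 1 ≤ t) : 0 < realE4 t ^ 3 - realE6 t ^ 2 := by
  have hq0 := Real.exp_pos (-2 * Real.pi * t)
  have hq1 := exp_neg_two_pi_mul_lt ht
  exact lt_of_lt_of_le (mul_pos (by positivity) (by linarith)) (le_realE4_pow_sub_realE6_sq ht)

/-! ### The inequality for t ≥ 1 -/

/-- The restriction of `φ₀` to the imaginary axis. -/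
noncomputable def realPhi0 (t : ℝ) : ℝ :=
  1728 * ((realE2 t * realE4 t - realE6 t) ^ 2 / (realE4 t ^ 3 - realE6 t ^ 2))

/-- The restriction of `ψ_S` to the imaginary axis. -/
noncomputable def realPsiS (t : ℝ) : ℝ :=
  -128 * ((realTheta3 t ^ 4 + realTheta2 t ^ 4) / realTheta4 t ^ 8 +
    (realTheta2 t ^ 4 - realTheta4 t ^ 4) / realTheta3 t ^ 8)

lemma phi0_imagPoint (t : ℝ) (ht : 0 < t) : phi0 (imagPoint t ht) = (realPhi0 t : ℝ) := by
  simp only [phi0, realPhi0, E2_imagPoint, E4_imagPoint, E6_imagPoint]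
  push_cast
  rfl

lemma psiS_imagPoint (t : ℝ) (ht : 0 < t) : psiS (imagPoint t ht) = (realPsiS t : ℝ) := by
  simp only [psiS, realPsiS, Theta2_imagPoint, Theta3_imagPoint, Theta4_imagPoint]
  push_cast
  rfl

lemma realPhi0_le {t : ℝ} (ht : 1 ≤ t) : realPhi0 t ≤ 630500 * Real.exp (-2 * Real.pi * t) := by
  have hA := realE2_mul_realE4_sub_realE6_mem_Icc ht
  have hD := le_realE4_pow_sub_realE6_sq ht
  have hD0 := realE4_pow_sub_realE6_sq_pos ht
  have hq0 := Real.exp_pos (-2 * Real.pi * t)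
  have hq1 := exp_neg_two_pi_mul_lt ht
  rw [realPhi0, mul_div_assoc', div_le_iff₀ hD0]
  set q := Real.exp (-2 * Real.pi * t)
  have hA2 : (realE2 t * realE4 t - realE6 t) ^ 2 ≤ (758 * q) ^ 2 :=
    pow_le_pow_left₀ (le_trans (by positivity) hA.1) hA.2 2
  have hD' : 1576 * q ≤ realE4 t ^ 3 - realE6 t ^ 2 := by nlinarith
  calc _ ≤ 1728 * (758 * q) ^ 2 := by gcongr
    _ ≤ 630500 * q * (1576 * q) := by nlinarith
    _ ≤ _ := by gcongr

lemma realTheta4_pos_and_le {t : ℝ} (ht : 1 ≤ t) :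
    0 < realTheta4 t ∧ realTheta4 t ≤ 1 - 1.99 * Real.exp (-Real.pi * t) := by
  have h := abs_le.mp (abs_realTheta4_sub_le (zero_lt_one.trans_le ht))
  have hp0 := Real.exp_pos (-Real.pi * t)
  have hp1 := exp_neg_pi_mul_lt ht
  set p := Real.exp (-Real.pi * t)
  have h3 : p ^ 3 ≤ 0.0001 := by
    calc p ^ 3 ≤ 0.04324 ^ 3 := by gcongr
      _ ≤ _ := by norm_num
  have : 2 * p ^ 4 / (1 - p) ≤ 0.01 * p := by
    rw [div_le_iff₀ (by linarith)]
    nlinarith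
  constructor <;> linarith [h.1, h.2]

lemma le_neg_realPsiS {t : ℝ} (ht : 1 ≤ t) :
    128 * (59.5 * Real.exp (-Real.pi * t) + 142 * Real.exp (-Real.pi * t) ^ 2) ≤ -realPsiS t := by
  have h2 := (realTheta2_pow_mem_Icc (zero_lt_one.trans_le ht)).1
  have h3 := le_realTheta3 (zero_lt_one.trans_le ht)
  obtain ⟨h4, h4'⟩ := realTheta4_pos_and_le ht
  have hp0 := Real.exp_pos (-Real.pi * t)
  have hp1 := exp_neg_pi_mul_lt ht
  set p := Real.exp (-Real.pi * t)
  have hy : 1 + 8 * p ≤ realTheta3 t ^ 4 := by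
    calc 1 + 8 * p ≤ (1 + 2 * p) ^ 4 := by
          have := one_add_mul_le_pow (a := 2 * p) (by linarith) 4
          norm_num at this
          linarith
      _ ≤ _ := by gcongr
  have hz : realTheta4 t ^ 4 ≤ 1 - 6.5 * p := by
    have h1 : realTheta4 t ^ 2 ≤ 1 - 3.8 * p := by nlinarith
    nlinarith [sq_nonneg (realTheta4 t)]
  have hz0 : 0 < realTheta4 t ^ 4 := by positivity
  rw [realPsiS, show realTheta4 t ^ 8 = (realTheta4 t ^ 4) ^ 2 by ring,
    show realTheta3 t ^ 8 = (realTheta3 t ^ 4) ^ 2 by ring]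
  generalize realTheta2 t ^ 4 = x at *
  generalize realTheta3 t ^ 4 = y at *
  generalize realTheta4 t ^ 4 = z at *
  -- Second-order Taylor polynomial of (1 - u)⁻² at u = 6.5p; `e3` uses u = -8p.
  have e1 : 1 + 13 * p + 126.75 * p ^ 2 ≤ 1 / z ^ 2 := by
    rw [le_div_iff₀ (by positivity)]
    calc (1 + 13 * p + 126.75 * p ^ 2) * z ^ 2
        ≤ (1 + 13 * p + 126.75 * p ^ 2) * (1 - 6.5 * p) ^ 2 := by gcongr
      _ ≤ 1 := by nlinarith [pow_pos hp0 3, pow_pos hp0 4]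
  have e2 : (y + x) / z ^ 2 ≥ (1 + 24 * p) * (1 + 13 * p + 126.75 * p ^ 2) := by
    rw [div_eq_mul_one_div]
    have : 1 + 24 * p ≤ y + x := by linarith
    have : 0 ≤ y + x := by linarith
    gcongr
  have hy0 : 0 < y := by linarith
  have e3 : 1 / y ^ 2 ≤ 1 - 16 * p + 192 * p ^ 2 := by
    rw [div_le_iff₀ (by positivity)]
    calc (1 : ℝ) ≤ (1 - 16 * p + 192 * p ^ 2) * (1 + 8 * p) ^ 2 := by
          nlinarith [pow_pos hp0 3, pow_pos hp0 4]
      _ ≤ _ := by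
          have : 0 ≤ 1 - 16 * p + 192 * p ^ 2 := by nlinarith
          gcongr
  have e4 : z / y ^ 2 ≤ (1 - 6.5 * p) * (1 - 16 * p + 192 * p ^ 2) := by
    rw [div_eq_mul_one_div]
    have : 0 ≤ 1 - 6.5 * p := by linarith
    gcongr
  -- The term x / y² is dropped; this costs about 16p of the true leading term 80p, and what remains
  -- is still enough.
  have e5 : (x - z) / y ^ 2 ≥ -(z / y ^ 2) := by
    rw [← neg_div]
    gcongr
    linarith
  nlinarith [pow_pos hp0 3]

lemma realPhi0_lt_of_one_le {t : ℝ} (ht : 1 ≤ t) :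
    0 ≤ realPhi0 t ∧ realPhi0 t < -(36 / Real.pi ^ 2 * realPsiS t) := by
  have hφ := realPhi0_le ht
  have hψ := le_neg_realPsiS ht
  have hp0 := Real.exp_pos (-Real.pi * t)
  have hp1 := exp_neg_pi_mul_lt ht
  refine ⟨mul_nonneg (by norm_num)
    (div_nonneg (sq_nonneg _) (realE4_pow_sub_realE6_sq_pos ht).le), ?_⟩
  rw [exp_neg_two_pi_mul] at hφ
  set p := Real.exp (-Real.pi * t)
  have hπ : (3.6475 : ℝ) ≤ 36 / Real.pi ^ 2 := by
    rw [le_div_iff₀ (by positivity)]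
    nlinarith [Real.pi_lt_d4, Real.pi_pos]
  calc realPhi0 t ≤ 630500 * p ^ 2 := hφ
    _ < 3.6475 * (128 * (59.5 * p + 142 * p ^ 2)) := by nlinarith
    _ ≤ 36 / Real.pi ^ 2 * -realPsiS t := by gcongr
    _ = _ := by ring

/-! ### The inequality for t ≤ 1, by inversion -/

lemma realPhi0_inv {t : ℝ} (ht : 0 < t) : realPhi0 t⁻¹ = 36 / (Real.pi * t) ^ 2 *
    (1728 * (realE4 t - Real.pi * t / 6 * (realE2 t * realE4 t - realE6 t)) ^ 2 /
      (realE4 t ^ 3 - realE6 t ^ 2)) := by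
  have hπ := Real.pi_ne_zero
  have ht' := ht.ne'
  have hn : realE2 t⁻¹ * realE4 t⁻¹ - realE6 t⁻¹ = 6 * t ^ 5 / Real.pi *
      (realE4 t - Real.pi * t / 6 * (realE2 t * realE4 t - realE6 t)) := by
    rw [realE2_inv ht, realE4_inv ht, realE6_inv ht]
    field_simp
    ring
  have hd : realE4 t⁻¹ ^ 3 - realE6 t⁻¹ ^ 2 = t ^ 12 * (realE4 t ^ 3 - realE6 t ^ 2) := by
    rw [realE4_inv ht, realE6_inv ht]
    ring
  rw [realPhi0, hn, hd, mul_pow, mul_div_mul_comm]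
  have : (6 * t ^ 5 / Real.pi) ^ 2 / t ^ 12 = 36 / (Real.pi * t) ^ 2 := by
    field_simp
    ring
  rw [this]
  ring

lemma realPsiS_inv {t : ℝ} (ht : 0 < t) : realPsiS t⁻¹ = -(t ^ 2)⁻¹ *
    (128 * ((realTheta3 t ^ 4 + realTheta4 t ^ 4) / (realTheta2 t ^ 4) ^ 2 +
      (realTheta4 t ^ 4 - realTheta2 t ^ 4) / (realTheta3 t ^ 4) ^ 2)) := by
  have ht' := ht.ne'
  have key (a b : ℝ) : (t ^ 2 * a) / (t ^ 2 * b) ^ 2 = (t ^ 2)⁻¹ * (a / b ^ 2) := by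
    rw [mul_pow, mul_div_mul_comm]
    congr 1
    field_simp
  rw [realPsiS, show realTheta4 t⁻¹ ^ 8 = (realTheta4 t⁻¹ ^ 4) ^ 2 by ring,
    show realTheta3 t⁻¹ ^ 8 = (realTheta3 t⁻¹ ^ 4) ^ 2 by ring, realTheta2_inv ht,
    realTheta3_inv ht, realTheta4_inv ht, ← mul_add, ← mul_sub, key, key]
  ring

lemma eisenstein_quotient_le {t : ℝ} (ht : 1 ≤ t) :
    1728 * (realE4 t - Real.pi * t / 6 * (realE2 t * realE4 t - realE6 t)) ^ 2 /
      (realE4 t ^ 3 - realE6 t ^ 2) ≤ 1 / Real.exp (-2 * Real.pi * t) - 175 := by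
  obtain ⟨hA, hA'⟩ := realE2_mul_realE4_sub_realE6_mem_Icc ht
  obtain ⟨-, ⟨h4, h4'⟩, -⟩ := eisenstein_bounds ht
  have hD := le_realE4_pow_sub_realE6_sq ht
  have hD0 := realE4_pow_sub_realE6_sq_pos ht
  have hq0 := Real.exp_pos (-2 * Real.pi * t)
  have hq1 := exp_neg_two_pi_mul_lt ht
  have htq := mul_exp_neg_two_pi_mul_lt ht
  have hπ := Real.pi_gt_d4
  have hπ' := Real.pi_lt_d4
  set q := Real.exp (-2 * Real.pi * t)
  generalize realE2 t * realE4 t - realE6 t = A at *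
  have hs : 0.5235 ≤ Real.pi * t / 6 := by nlinarith
  have hlo : 0.5235 * (708 * q) ≤ Real.pi * t / 6 * A := by gcongr
  -- Keeps the base of the square nonnegative, so that its upper bound can be squared.
  have hhi : Real.pi * t / 6 * A ≤ 1 := by
    calc Real.pi * t / 6 * A ≤ Real.pi * t / 6 * (758 * q) := by gcongr
      _ = Real.pi * (758 / 6 * (t * q)) := by ring
      _ ≤ 3.1416 * (758 / 6 * 0.00187) := by gcongr
      _ ≤ 1 := by norm_num
  -- 244.2 - 0.5235 · 708 < -126.
  have hU : (realE4 t - Real.pi * t / 6 * A) ^ 2 ≤ (1 - 126 * q) ^ 2 :=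
    pow_le_pow_left₀ (by linarith) (by linarith) 2
  rw [div_le_iff₀ hD0]
  calc 1728 * (realE4 t - Real.pi * t / 6 * A) ^ 2 ≤ 1728 * (1 - 126 * q) ^ 2 := by gcongr
    _ ≤ 1728 * ((1 - 175 * q) * (1 - 47 * q)) := by nlinarith
    _ = (1 / q - 175) * (1728 * q * (1 - 47 * q)) := by field_simp
    _ ≤ _ := by
      have : 0 ≤ 1 / q - 175 := by
        rw [sub_nonneg, le_div_iff₀ hq0]
        linarith
      gcongr

lemma le_theta_quotient {t : ℝ} (ht : 1 ≤ t) :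
    1 / Real.exp (-2 * Real.pi * t) - 98 ≤
    128 * ((realTheta3 t ^ 4 + realTheta4 t ^ 4) / (realTheta2 t ^ 4) ^ 2 +
      (realTheta4 t ^ 4 - realTheta2 t ^ 4) / (realTheta3 t ^ 4) ^ 2) := by
  have ht0 := zero_lt_one.trans_le ht
  obtain ⟨h2, h2'⟩ := realTheta2_pow_mem_Icc ht0
  have h3 := le_realTheta3 ht0
  have h34 := two_le_realTheta3_add_realTheta4 ht0
  have hp0 := Real.exp_pos (-Real.pi * t)
  have hp1 := exp_neg_pi_mul_lt ht
  have hq1 := exp_neg_two_pi_mul_lt ht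
  rw [exp_neg_two_pi_mul] at *
  set p := Real.exp (-Real.pi * t)
  -- Power mean inequality, from Θ₃ + Θ₄ ≥ 2.
  have hyz : 2 ≤ realTheta3 t ^ 4 + realTheta4 t ^ 4 := by
    nlinarith [sq_nonneg (realTheta3 t - 1), sq_nonneg (realTheta4 t - 1),
      sq_nonneg (realTheta3 t ^ 2 - 1), sq_nonneg (realTheta4 t ^ 2 - 1)]
  have hy : 1 ≤ realTheta3 t ^ 4 := one_le_pow₀ (by linarith)
  have hz : 0 ≤ realTheta4 t ^ 4 := by positivity
  generalize realTheta2 t ^ 4 = x at *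
  generalize realTheta3 t ^ 4 = y at *
  generalize realTheta4 t ^ 4 = z at *
  have hx0 : 0 < x := lt_of_lt_of_le (by positivity) h2
  have hb : 1 - 4 * p ^ 2 ≤ (1 - p ^ 2) ^ 4 := by
    have := one_add_mul_le_pow (a := -p ^ 2) (by linarith) 4
    norm_num at this
    linarith
  have hb8 : 1 - 8 * p ^ 2 ≤ (1 - p ^ 2) ^ 8 := by
    have := one_add_mul_le_pow (a := -p ^ 2) (by linarith) 8
    norm_num at this
    linarith
  have hx : x ≤ 0.7 := by
    refine h2'.trans ?_
    rw [div_le_iff₀ (by nlinarith)]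
    nlinarith
  have hpos : 0 < 1 - p ^ 2 := by linarith
  have e1 : 1 / p ^ 2 - 8 ≤ 128 * ((y + z) / x ^ 2) := by
    calc 1 / p ^ 2 - 8 = (1 - 8 * p ^ 2) / p ^ 2 := by field_simp
      _ ≤ (1 - p ^ 2) ^ 8 / p ^ 2 := by gcongr
      _ = 128 * (2 / (16 * p / (1 - p ^ 2) ^ 4) ^ 2) := by field_simp; ring
      _ ≤ 128 * ((y + z) / x ^ 2) := by gcongr
  have e2 : -0.7 ≤ (z - x) / y ^ 2 := by
    rw [le_div_iff₀ (by positivity)]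
    nlinarith
  -- 8 + 128 · 0.7 = 97.6 ≤ 98.
  linarith

lemma realPhi0_inv_lt_of_one_le {t : ℝ} (ht : 1 ≤ t) :
    0 ≤ realPhi0 t⁻¹ ∧ realPhi0 t⁻¹ < -(36 / Real.pi ^ 2 * realPsiS t⁻¹) := by
  have ht0 := zero_lt_one.trans_le ht
  have h1 := eisenstein_quotient_le ht
  have h2 := le_theta_quotient ht
  have hD0 := realE4_pow_sub_realE6_sq_pos ht
  have hc : 0 < 36 / (Real.pi * t) ^ 2 := by positivity
  rw [realPhi0_inv ht0, realPsiS_inv ht0]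
  refine ⟨by positivity, ?_⟩
  refine (mul_lt_mul_of_pos_left (h1.trans_lt ((sub_lt_sub_left (by norm_num) _).trans_le h2))
    hc).trans_eq ?_
  rw [mul_pow, ← div_div, div_eq_mul_inv (36 / Real.pi ^ 2)]
  ring

lemma realPhi0_lt {t : ℝ} (ht : 0 < t) :
    0 ≤ realPhi0 t ∧ realPhi0 t < -(36 / Real.pi ^ 2 * realPsiS t) := by
  rcases le_total 1 t with h | h
  · exact realPhi0_lt_of_one_le h
  · simpa using realPhi0_inv_lt_of_one_le (one_le_inv₀ ht |>.mpr h)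

end DimEight

/-- The order on `ℂ` is the one of `ComplexOrder`: `0 < w` (resp. `w < 0`) says that `w` is real
and positive (resp. real and negative). -/
theorem theorem1p1 (t : ℝ) (ht : 0 < t) :
    0 < DimEight.phi0 (DimEight.imagPoint t ht)
        - (36 / (Real.pi : ℂ) ^ 2) * DimEight.psiS (DimEight.imagPoint t ht) ∧
    DimEight.phi0 (DimEight.imagPoint t ht)
        + (36 / (Real.pi : ℂ) ^ 2) * DimEight.psiS (DimEight.imagPoint t ht) < 0 := by
  obtain ⟨h0, h1⟩ := DimEight.realPhi0_lt ht
  rw [DimEight.phi0_imagPoint, DimEight.psiS_imagPoint]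
  constructor
  · have h : 0 < DimEight.realPhi0 t - 36 / Real.pi ^ 2 * DimEight.realPsiS t := by linarith
    exact_mod_cast h
  · have h : DimEight.realPhi0 t + 36 / Real.pi ^ 2 * DimEight.realPsiS t < 0 := by linarith
    exact_mod_cast h
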